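/- **Conventions.** A subset of $\mathbb{R}^m$ is semialgebraic if it belongs to the smallest class of subsets containing all sets $\{P>0\}$ ($P$ a real polynomial) and closed under complements and finite intersections. A Nash map on an open semialgebraic set $W\subset\mathbb{R}^m$ is a map $W\to\mathbb{R}^n$ whose coordinate functions are analytic and have semialgebraic graph. A Nash atlas on a space is an atlas whose charts have semialgebraic image and whose transition maps are Nash maps in both directions. A map $f:M_1\to M_2$ between spaces with Nash atlases is locally Nash if it is continuous and for every $p\in M_1$ and every chart $(V,\psi)$ of $M_2$ with $f(p)\in V$ there are a chart $(U,\phi)$ of $M_1$ and an open $U'\subset U$ with $p\in U'$, $f(U')\subset V$ and $\psi\circ f\circ\phi^{-1}:\phi(U')\to\psi(V)$ a Nash map. A locally Nash group is a group with a Nash atlas for which multiplication and inversion are locally Nash maps; an isomorphism of locally Nash groups is a group isomorphism which is locally Nash together with its inverse. A meromorphic map $f=(f_1,\dots,f_n):\mathbb{C}^n\to\mathbb{C}^n$ is an $n$-tuple of elements of the quotient field of the ring of analytic functions on $\mathbb{C}^n$. It is real if each $f_i$ is a quotient of two analytic functions on $\mathbb{C}^n$ that are real on $\mathbb{R}^n$.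 It admits an algebraic addition theorem (AAT) if $f_1,\dots,f_n$ are algebraically independent over $\mathbb{C}$ and each $f_i(u+v)$ is algebraic over $\mathbb{C}(f_1(u),\dots,f_n(u),f_1(v),\dots,f_n(v))$. Its period group is $\Lambda_f=\{a\in\mathbb{C}^n: f(u+a)=f(u)\}$, the equality being one of meromorphic maps. For a real meromorphic map $f$ admitting an AAT, $(\mathbb{R}^n,+,f)$ denotes a locally Nash group given by $(\mathbb{R}^n,+)$ with the Nash atlas of all translates $(x+V,\ u\mapsto\phi(u-x))$, $x\in\mathbb{R}^n$, of a chart $\phi:V\to\mathbb{R}^n$, where $V$ is an open neighbourhood of $0$ and $\phi(u)=f(u+k)$ for some $k\in\mathbb{R}^n$ is an analytic diffeomorphism onto its open image; it is part of the notation that such $k$ and $V$ exist and that the atlas makes $(\mathbb{R}^n,+)$ a locally Nash group. **Proposition.** Let $f,g:\mathbb{C}^n\to\mathbb{C}^n$ be real meromorphic maps admitting an AAT, and let $(\mathbb{R}^n,+,f)$ and $(\mathbb{R}^n,+,g)$ be locally Nash groups (for any admissible choices of $k$ and $V$). If $(\mathbb{R}^n,+,f)$ and $(\mathbb{R}^n,+,g)$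 are isomorphic as locally Nash groups, then $\Lambda_f$ and $\Lambda_g$ are discrete subgroups of $(\mathbb{C}^n,+)$ and $$\operatorname{rank}\Lambda_f=\operatorname{rank}\Lambda_g ,$$ where the rank of a discrete subgroup is its rank as a free $\mathbb{Z}$-module. -/

import Mathlib

noncomputable section

namespace LocallyNash

open Set

/-! ### Semialgebraic sets and Nash maps -/

/-- Semialgebraic subsets of `ℝ^ι`: the smallest class of subsets that contains the sets
`{x | 0 < P x}`, `P` a real polynomial, and is closed under complements and finite intersections
(hence also under finite unions). -/
inductive IsSemialgebraic {ι : Type} : Set (ι → ℝ) → Prop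
  | pos (P : MvPolynomial ι ℝ) : IsSemialgebraic {x | 0 < MvPolynomial.eval x P}
  | compl {S : Set (ι → ℝ)} : IsSemialgebraic S → IsSemialgebraic Sᶜ
  | inter {S T : Set (ι → ℝ)} : IsSemialgebraic S → IsSemialgebraic T → IsSemialgebraic (S ∩ T)

/-- The graph of the restriction of `F` to `W`, as a subset of `ℝ^(ι + 1)`; the coordinate `none`
holds the value of the function. -/
def scalarGraphOn {ι : Type} (F : (ι → ℝ) → ℝ) (W : Set (ι → ℝ)) : Set (Option ι → ℝ) :=
  {z | (fun i => z (some i)) ∈ W ∧ z none = F (fun i => z (some i))}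

/-- `F : W → ℝ^κ` is a Nash map: `W ⊆ ℝ^ι` is open and semialgebraic, and each coordinate function
of `F` is analytic and semialgebraic on `W`. -/
def IsNashMapOn {ι κ : Type} [Fintype ι] (F : (ι → ℝ) → (κ → ℝ)) (W : Set (ι → ℝ)) : Prop :=
  IsOpen W ∧ IsSemialgebraic W ∧
    ∀ j, AnalyticOnNhd ℝ (fun x => F x j) W ∧ IsSemialgebraic (scalarGraphOn (fun x => F x j) W)

/-! ### Locally Nash manifolds, maps and groups -/

section Manifold

variable {M N : Type} [TopologicalSpace M] [TopologicalSpace N] {ι κ : Type} [Fintype ι] [Fintype κ]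

/-- Two charts are Nash compatible: their images are semialgebraic and the transition map between
them is a Nash diffeomorphism. (When the domains are disjoint the last clause is void.) -/
def NashCompatible (φ ψ : OpenPartialHomeomorph M (ι → ℝ)) : Prop :=
  IsSemialgebraic φ.target ∧ IsSemialgebraic ψ.target ∧
    IsNashMapOn (φ.symm.trans ψ) (φ.symm.trans ψ).source ∧
    IsNashMapOn (ψ.symm.trans φ) (ψ.symm.trans φ).source

/-- A Nash atlas: a family of charts that covers the space and whose members are pairwise Nash
compatible. -/
def IsNashAtlas (A : Set (OpenPartialHomeomorph M (ι → ℝ))) : Prop :=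
  (∀ p : M, ∃ φ ∈ A, p ∈ φ.source) ∧ ∀ φ ∈ A, ∀ ψ ∈ A, NashCompatible φ ψ

/-- `f : M → N` is a locally Nash map with respect to the Nash atlases `A` of `M`, `B` of `N`. -/
def IsLocallyNashMap (A : Set (OpenPartialHomeomorph M (ι → ℝ)))
    (B : Set (OpenPartialHomeomorph N (κ → ℝ))) (f : M → N) : Prop :=
  Continuous f ∧ ∀ p : M, ∀ ψ ∈ B, f p ∈ ψ.source →
    ∃ φ ∈ A, ∃ U : Set M, IsOpen U ∧ U ⊆ φ.source ∧ p ∈ U ∧ f '' U ⊆ ψ.source ∧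
      IsNashMapOn (fun x => ψ (f (φ.symm x))) (φ '' U)

/-- The product atlas on `M × N`, with `ℝ^ι × ℝ^κ` identified with `ℝ^(ι ⊕ κ)`. -/
def prodAtlas (A : Set (OpenPartialHomeomorph M (ι → ℝ)))
    (B : Set (OpenPartialHomeomorph N (κ → ℝ))) :
    Set (OpenPartialHomeomorph (M × N) (ι ⊕ κ → ℝ)) :=
  {χ | ∃ φ ∈ A, ∃ ψ ∈ B,
    χ = (φ.prod ψ).transHomeomorph (Homeomorph.sumArrowHomeomorphProdArrow (X := ℝ)).symm}

end Manifold

section Group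

variable {G H : Type} [TopologicalSpace G] [AddGroup G] [TopologicalSpace H] [AddGroup H]
  {ι κ : Type} [Fintype ι] [Fintype κ]

/-- The (additively written) group `G` with the atlas `A` is a locally Nash group: `A` is a Nash
atlas and the group operations are locally Nash maps. -/
def IsLocallyNashGroup (A : Set (OpenPartialHomeomorph G (ι → ℝ))) : Prop :=
  IsNashAtlas A ∧ IsLocallyNashMap (prodAtlas A A) A (fun p : G × G => p.1 + p.2) ∧
    IsLocallyNashMap A A (fun x : G => -x)

/-- `(G, A)` and `(H, B)` are isomorphic as locally Nash groups: there is an isomorphism of abstract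
groups which is a locally Nash map in both directions. -/
def LocallyNashIsomorphic (A : Set (OpenPartialHomeomorph G (ι → ℝ)))
    (B : Set (OpenPartialHomeomorph H (κ → ℝ))) : Prop :=
  ∃ α : G ≃+ H, IsLocallyNashMap A B α ∧ IsLocallyNashMap B A α.symm

end Group

/-! ### Meromorphic functions on `ℂ^ι` -/

/-- The ring of analytic functions on all of `ℂ^ι`. -/
def Entire (ι : Type) [Fintype ι] : Subalgebra ℂ ((ι → ℂ) → ℂ) where
  carrier := {f | AnalyticOnNhd ℂ f univ}
  mul_mem' hf hg := AnalyticOnNhd.mul hf hg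
  add_mem' hf hg := AnalyticOnNhd.add hf hg
  algebraMap_mem' _ := analyticOnNhd_const

instance Entire.instIsDomain (ι : Type) [Fintype ι] : IsDomain (Entire ι) := by
  have : NoZeroDivisors (Entire ι) := by
    refine ⟨fun {f g} h => ?_⟩
    by_contra! hc
    obtain ⟨hf, hg⟩ := hc
    obtain ⟨z, hz⟩ : ∃ z, f.1 z ≠ 0 := by
      by_contra! H
      exact hf (Subtype.ext (funext H))
    refine hg (Subtype.ext ?_)
    refine AnalyticOnNhd.eq_of_eventuallyEq (z₀ := z) g.2 analyticOnNhd_const ?_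
    filter_upwards [(f.2 z (mem_univ z)).continuousAt.eventually_ne hz] with w hw
    have := congrFun (congrArg Subtype.val h) w
    exact (mul_eq_zero.1 this).resolve_left hw
  exact NoZeroDivisors.to_isDomain _

/-- The field of meromorphic functions on `ℂ^ι`, the quotient field of the ring of analytic
functions on `ℂ^ι`. -/
def Mero (ι : Type) [Fintype ι] : Type := FractionRing (Entire ι)

instance Mero.instField (ι : Type) [Fintype ι] : Field (Mero ι) :=
  inferInstanceAs (Field (FractionRing (Entire ι)))

instance Mero.instAlgebraEntire (ι : Type) [Fintype ι] : Algebra (Entire ι) (Mero ι) :=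
  inferInstanceAs (Algebra (Entire ι) (FractionRing (Entire ι)))

instance Mero.instIsFractionRing (ι : Type) [Fintype ι] : IsFractionRing (Entire ι) (Mero ι) :=
  inferInstanceAs (IsFractionRing (Entire ι) (FractionRing (Entire ι)))

/-- The constants in the field of meromorphic functions. -/
instance Mero.instAlgebra (ι : Type) [Fintype ι] : Algebra ℂ (Mero ι) :=
  ((algebraMap (Entire ι) (Mero ι)).comp (algebraMap ℂ (Entire ι))).toAlgebra

instance Mero.instIsScalarTower (ι : Type) [Fintype ι] : IsScalarTower ℂ (Entire ι) (Mero ι) :=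
  IsScalarTower.of_algebraMap_eq' rfl

/-- `F = g / h` with `g` and `h` analytic on `ℂ^ι` and `h` not identically zero. -/
def IsQuotient {ι : Type} [Fintype ι] (F : Mero ι) (g h : Entire ι) : Prop :=
  h ≠ 0 ∧ F = algebraMap (Entire ι) (Mero ι) g / algebraMap (Entire ι) (Mero ι) h

/-- An analytic function on `ℂ^ι` is real if it takes real values on `ℝ^ι`. -/
def IsRealEntire {ι : Type} [Fintype ι] (g : Entire ι) : Prop :=
  ∀ x : ι → ℝ, ∃ y : ℝ, g.1 (fun i => (x i : ℂ)) = (y : ℂ)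

/-- A real meromorphic map `ℂ^ι → ℂ^κ`: each coordinate is a quotient of two real analytic
functions on `ℂ^ι`. -/
def IsRealMeromorphic {ι κ : Type} [Fintype ι] (f : κ → Mero ι) : Prop :=
  ∀ j, ∃ g h : Entire ι, IsRealEntire g ∧ IsRealEntire h ∧ IsQuotient (f j) g h

section Pullback

variable {ι κ : Type} [Fintype ι] [Fintype κ]

/-- Composition `g ↦ g ∘ σ` of analytic functions on `ℂ^ι` with an analytic map
`σ : ℂ^κ → ℂ^ι`. -/
def Entire.comp (σ : (κ → ℂ) → (ι → ℂ)) (hσ : AnalyticOnNhd ℂ σ univ) : Entire ι →+* Entire κ where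
  toFun g := ⟨fun z => g.1 (σ z), fun z _ => (g.2 (σ z) (mem_univ _)).comp (hσ z (mem_univ z))⟩
  map_one' := rfl
  map_mul' _ _ := rfl
  map_zero' := rfl
  map_add' _ _ := rfl

lemma Entire.comp_injective (σ : (κ → ℂ) → (ι → ℂ)) (hσ : AnalyticOnNhd ℂ σ univ)
    (hs : Function.Surjective σ) : Function.Injective (Entire.comp σ hσ) := by
  intro g h H
  refine Subtype.ext (funext fun w => ?_)
  obtain ⟨z, rfl⟩ := hs w
  exact congrFun (congrArg Subtype.val H) z

/-- Composition `F ↦ F ∘ σ` of meromorphic functions on `ℂ^ι` with a surjective analytic map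
`σ : ℂ^κ → ℂ^ι`; it sends `g / h` to `(g ∘ σ) / (h ∘ σ)`. -/
def Mero.comp (σ : (κ → ℂ) → (ι → ℂ)) (hσ : AnalyticOnNhd ℂ σ univ)
    (hs : Function.Surjective σ) : Mero ι →+* Mero κ :=
  IsFractionRing.map (Entire.comp_injective σ hσ hs)

lemma Mero.comp_algebraMap (σ : (κ → ℂ) → (ι → ℂ)) (hσ : AnalyticOnNhd ℂ σ univ)
    (hs : Function.Surjective σ) (g : Entire ι) :
    Mero.comp σ hσ hs (algebraMap (Entire ι) (Mero ι) g) =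
      algebraMap (Entire κ) (Mero κ) (Entire.comp σ hσ g) := by
  unfold Mero.comp IsFractionRing.map
  exact IsLocalization.map_eq _ g

end Pullback

lemma surjective_translate {ι : Type} (a : ι → ℂ) :
    Function.Surjective (fun u : ι → ℂ => u + a) :=
  fun w => ⟨w - a, sub_add_cancel w a⟩

section Addition

variable {ι : Type} [Fintype ι]

lemma analyticOnNhd_inl : AnalyticOnNhd ℂ (fun (z : ι ⊕ ι → ℂ) (i : ι) => z (Sum.inl i)) univ :=
  AnalyticOnNhd.pi fun i =>
    (ContinuousLinearMap.proj (R := ℂ) (φ := fun _ : ι ⊕ ι => ℂ) (Sum.inl i)).analyticOnNhd univ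

lemma analyticOnNhd_inr : AnalyticOnNhd ℂ (fun (z : ι ⊕ ι → ℂ) (i : ι) => z (Sum.inr i)) univ :=
  AnalyticOnNhd.pi fun i =>
    (ContinuousLinearMap.proj (R := ℂ) (φ := fun _ : ι ⊕ ι => ℂ) (Sum.inr i)).analyticOnNhd univ

lemma analyticOnNhd_sum :
    AnalyticOnNhd ℂ (fun (z : ι ⊕ ι → ℂ) (i : ι) => z (Sum.inl i) + z (Sum.inr i)) univ :=
  AnalyticOnNhd.add analyticOnNhd_inl analyticOnNhd_inr

lemma analyticOnNhd_translate (a : ι → ℂ) : AnalyticOnNhd ℂ (fun u : ι → ℂ => u + a) univ :=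
  AnalyticOnNhd.add analyticOnNhd_id analyticOnNhd_const

/-- The function `F(u)` of the `2n` variables `(u, v)`. -/
def Mero.left : Mero ι →+* Mero (ι ⊕ ι) :=
  Mero.comp (fun z i => z (Sum.inl i)) analyticOnNhd_inl
    (fun w => ⟨Sum.elim w 0, rfl⟩)

/-- The function `F(v)` of the `2n` variables `(u, v)`. -/
def Mero.right : Mero ι →+* Mero (ι ⊕ ι) :=
  Mero.comp (fun z i => z (Sum.inr i)) analyticOnNhd_inr
    (fun w => ⟨Sum.elim 0 w, rfl⟩)

/-- The function `F(u + v)` of the `2n` variables `(u, v)`. -/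
def Mero.sum : Mero ι →+* Mero (ι ⊕ ι) :=
  Mero.comp (fun z i => z (Sum.inl i) + z (Sum.inr i)) analyticOnNhd_sum
    (fun w => ⟨Sum.elim w 0, by simp⟩)

/-- `f = (f_i)` admits an algebraic addition theorem: the `f_i` are algebraically independent over
`ℂ` and each `f_i(u + v)` is algebraic over the field `ℂ(f(u), f(v))`. -/
def AdmitsAAT (f : ι → Mero ι) : Prop :=
  AlgebraicIndependent ℂ f ∧
    ∀ i, IsAlgebraic
      (IntermediateField.adjoin ℂ
        (range (fun j => Mero.left (f j)) ∪ range (fun j => Mero.right (f j))))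
      (Mero.sum (f i))

/-- The translate `F(u + a)`. -/
def Mero.translate (a : ι → ℂ) : Mero ι →+* Mero ι :=
  Mero.comp (fun u => u + a) (analyticOnNhd_translate a) (surjective_translate a)

lemma Mero.translate_algebraMap (a : ι → ℂ) (g : Entire ι) :
    Mero.translate a (algebraMap (Entire ι) (Mero ι) g) =
      algebraMap (Entire ι) (Mero ι) (Entire.comp _ (analyticOnNhd_translate a) g) :=
  Mero.comp_algebraMap _ _ _ g

lemma Mero.translate_zero (F : Mero ι) : Mero.translate 0 F = F := by
  have h : (Mero.translate (0 : ι → ℂ)) = RingHom.id (Mero ι) := by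
    refine IsLocalization.ringHom_ext (nonZeroDivisors (Entire ι)) (RingHom.ext fun g => ?_)
    simp only [RingHom.comp_apply, RingHom.id_apply, Mero.translate_algebraMap]
    refine congrArg _ ?_
    exact Subtype.ext (funext fun z => by simp [Entire.comp])
  rw [h, RingHom.id_apply]

lemma Mero.translate_add (a b : ι → ℂ) (F : Mero ι) :
    Mero.translate (a + b) F = Mero.translate b (Mero.translate a F) := by
  have h : Mero.translate (a + b) = (Mero.translate b).comp (Mero.translate a) := by
    refine IsLocalization.ringHom_ext (nonZeroDivisors (Entire ι)) (RingHom.ext fun g => ?_)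
    simp only [RingHom.comp_apply, Mero.translate_algebraMap]
    refine congrArg _ ?_
    exact Subtype.ext (funext fun z => by simp [Entire.comp, add_assoc, add_comm b a])
  rw [h, RingHom.comp_apply]

/-- The group of periods `{a | f(u + a) = f(u)}` of a meromorphic map `f`. -/
def periodGroup {κ : Type} (f : κ → Mero ι) : AddSubgroup (ι → ℂ) where
  carrier := {a | ∀ j, Mero.translate a (f j) = f j}
  zero_mem' j := Mero.translate_zero (f j)
  add_mem' {a b} ha hb j := by rw [Mero.translate_add, ha j, hb j]
  neg_mem' {a} ha j := by
    conv_lhs => rw [← ha j]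
    rw [← Mero.translate_add, add_neg_cancel, Mero.translate_zero]

/-- For `F = g / h`, the identity `F(u + a) = F(u)` means `g(b) h(b + a) = h(b) g(b + a)` for
all `b`. -/
lemma Mero.translate_eq_iff {F : Mero ι} {g h : Entire ι} (H : IsQuotient F g h) (a : ι → ℂ) :
    Mero.translate a F = F ↔ ∀ b, g.1 b * h.1 (b + a) = h.1 b * g.1 (b + a) := by
  obtain ⟨h0, rfl⟩ := H
  have inj := IsFractionRing.injective (Entire ι) (Mero ι)
  have hs := surjective_translate a
  have hσ := analyticOnNhd_translate a
  have h1 : algebraMap (Entire ι) (Mero ι) h ≠ 0 := (map_ne_zero_iff _ inj).2 h0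
  have h2 : algebraMap (Entire ι) (Mero ι) (Entire.comp _ hσ h) ≠ 0 :=
    (map_ne_zero_iff _ inj).2 ((map_ne_zero_iff _ (Entire.comp_injective _ hσ hs)).2 h0)
  rw [map_div₀, Mero.translate_algebraMap, Mero.translate_algebraMap, div_eq_div_iff h2 h1,
    ← map_mul, ← map_mul, inj.eq_iff]
  constructor
  · intro E b
    have := congrFun (congrArg Subtype.val E) b
    change g.1 (b + a) * h.1 b = g.1 b * h.1 (b + a) at this
    rw [← this, mul_comm]
  · intro E
    refine Subtype.ext (funext fun b => ?_)
    change g.1 (b + a) * h.1 b = g.1 b * h.1 (b + a)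
    rw [E b, mul_comm]

end Addition

/-! ### The locally Nash groups `(ℝ^n, +, f)` -/

section Structure

variable {ι : Type} [Fintype ι]

/-- `φ` is a chart of the identity of `ℝ^ι` of the form `u ↦ f(u + k)` for some `k ∈ ℝ^ι`: an
analytic diffeomorphism from an open neighbourhood of `0` onto an open set such that, writing
`f_i = g / h`, one has `g(u + k) = φ_i(u) h(u + k)` on the domain of `φ`. (As `h` does not vanish
identically on any nonempty open subset of `ℝ^ι`, this determines the continuous map `φ`; it allows
removable zeros of `h`.) -/
def IsChartOf (f : ι → Mero ι) (φ : OpenPartialHomeomorph (ι → ℝ) (ι → ℝ)) : Prop :=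
  0 ∈ φ.source ∧ AnalyticOnNhd ℝ φ φ.source ∧ AnalyticOnNhd ℝ φ.symm φ.target ∧
    ∃ k : ι → ℝ, ∀ i, ∃ g h : Entire ι, IsQuotient (f i) g h ∧
      ∀ u ∈ φ.source, g.1 (fun j => ((u j + k j : ℝ) : ℂ)) =
        (φ u i : ℂ) * h.1 (fun j => ((u j + k j : ℝ) : ℂ))

/-- The atlas of all translates `x + V → ℝ^ι, u ↦ φ(-x + u)` of a chart `φ : V → ℝ^ι`. -/
def translateAtlas (φ : OpenPartialHomeomorph (ι → ℝ) (ι → ℝ)) :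
    Set (OpenPartialHomeomorph (ι → ℝ) (ι → ℝ)) :=
  range fun x : ι → ℝ => (Homeomorph.addLeft (-x)).transOpenPartialHomeomorph φ

/-- The atlas `A` makes `ℝ^ι` into the locally Nash group `(ℝ^ι, +, f)`: it consists of the
translates of a chart `u ↦ f(u + k)` of the identity, and the result is a locally Nash group. -/
def IsStructureOf (f : ι → Mero ι) (A : Set (OpenPartialHomeomorph (ι → ℝ) (ι → ℝ))) : Prop :=
  (∃ φ, IsChartOf f φ ∧ A = translateAtlas φ) ∧ IsLocallyNashGroup A

end Structure

end LocallyNash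

end

/-! An isomorphism `α` is a continuous additive automorphism of `ℝ^n`, hence linear, and extends to
a complex linear automorphism `T` of `ℂ^n`. Read in charts, `α` has semialgebraic coordinates, so
each satisfies a nonzero polynomial relation. The charts are translates of `f` and `g`, and an
identity on a nonempty open subset of `ℝ^n` persists on `ℂ^n`; so each `g_j ∘ σ`, with `σ` affine of
linear part `T`, is algebraic over `ℂ(f)`.

Translation by a period `a` of `f` fixes `ℂ(f)`, so it sends `g_j ∘ σ` to another root of the same
polynomial. There are finitely many roots, hence some positive multiple of `a` fixes `g_j ∘ σ`, and
a positive multiple of `T a` is a period of `g` (`exists_nsmul_mem_periodGroup`). As `Λ_f` is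
finitely generated, one integer `N` serves for all periods, and `N • T` embeds `Λ_f` in `Λ_g`. The
inverse of `α` gives the other inequality.

Discreteness comes from the charts: they have analytic inverses, so `f` has invertible complex
derivative at some real point, is injective near it, and has no small nonzero periods. -/

namespace LocallyNash

open Set Filter Topology

/-! ### Semialgebraic graphs and polynomial relations -/

/-- A semialgebraic set has its frontier contained in a proper algebraic set. -/
lemma IsSemialgebraic.exists_frontier_subset {ι : Type} {S : Set (ι → ℝ)} (hS : IsSemialgebraic S) :
    ∃ P : MvPolynomial ι ℝ, P ≠ 0 ∧ ∀ z ∈ frontier S, MvPolynomial.eval z P = 0 := by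
  induction hS with
  | pos P =>
    by_cases hP : P = 0
    -- The set is empty here, and so is its frontier.
    · exact ⟨1, one_ne_zero, by simp [hP]⟩
    · refine ⟨P, hP, fun z hz => ?_⟩
      exact (frontier_lt_subset_eq continuous_const (MvPolynomial.continuous_eval P) hz).symm
  | compl _ ih => simpa only [frontier_compl] using ih
  | inter _ _ ihS ihT =>
    obtain ⟨P, hP, hPz⟩ := ihS
    obtain ⟨Q, hQ, hQz⟩ := ihT
    refine ⟨P * Q, mul_ne_zero hP hQ, fun z hz => ?_⟩
    rw [map_mul, mul_eq_zero]
    exact (frontier_inter_subset _ _ hz).imp (fun h => hPz z h.1) (fun h => hQz z h.2)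

/-- A graph meets each line in the direction `none` at most once. Hence it lies in its own frontier,
where a nonzero polynomial vanishes. -/
lemma interior_scalarGraphOn {ι : Type} (F : (ι → ℝ) → ℝ) (W : Set (ι → ℝ)) :
    interior (scalarGraphOn F W) = ∅ := by
  refine eq_empty_of_forall_notMem fun z hz => ?_
  classical
  have hc : ContinuousAt (fun t : ℝ => Function.update z none t) (z none) := by fun_prop
  have hmem : ∀ᶠ t in 𝓝 (z none), Function.update z none t ∈ scalarGraphOn F W := by
    refine hc.eventually (mem_interior_iff_mem_nhds.1 ?_)
    simpa using hz
  have hval : ∀ᶠ t in 𝓝 (z none), t = F fun i => z (some i) := by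
    filter_upwards [hmem] with t ht
    simpa [scalarGraphOn] using ht.2
  have h0 := hval.self_of_nhds
  rw [← h0] at hval
  have hne : ∀ᶠ t in 𝓝[≠] (z none), False := by
    filter_upwards [hval.filter_mono nhdsWithin_le_nhds, self_mem_nhdsWithin] with t h1 h2
    exact h2 h1
  exact (hne.exists).elim fun _ h => h

/-- A function with semialgebraic graph is algebraic over the polynomials. -/
lemma exists_polynomial_of_isSemialgebraic_graph {ι : Type} {F : (ι → ℝ) → ℝ} {W : Set (ι → ℝ)}
    (h : IsSemialgebraic (scalarGraphOn F W)) :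
    ∃ P : MvPolynomial (Option ι) ℝ, P ≠ 0 ∧
      ∀ x ∈ W, MvPolynomial.eval (fun o => o.elim (F x) x) P = 0 := by
  obtain ⟨P, hP, hz⟩ := h.exists_frontier_subset
  refine ⟨P, hP, fun x hx => hz _ ⟨subset_closure ⟨hx, rfl⟩, ?_⟩⟩
  simp [interior_scalarGraphOn]

/-! ### Real points and the identity theorem -/

variable {ι κ : Type}

/-- The inclusion of `ℝ^ι` into `ℂ^ι`. -/
def realPoint (x : ι → ℝ) : ι → ℂ := fun i => (x i : ℂ)

lemma realPoint_add (x y : ι → ℝ) : realPoint (x + y) = realPoint x + realPoint y := by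
  ext i; simp [realPoint]

lemma realPoint_sub (x y : ι → ℝ) : realPoint (x - y) = realPoint x - realPoint y := by
  ext i; simp [realPoint]

lemma realPoint_smul (t : ℝ) (x : ι → ℝ) : realPoint (t • x) = (t : ℂ) • realPoint x := by
  ext i; simp [realPoint]

lemma realPoint_re_add_im (z : ι → ℂ) :
    realPoint (fun i => (z i).re) + Complex.I • realPoint (fun i => (z i).im) = z := by
  ext i; simp [realPoint, mul_comm Complex.I, Complex.re_add_im]

variable [Fintype ι] [Fintype κ]

/-- An entire function vanishing on a real segment of a complex line vanishes on that line. -/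
lemma Entire.eq_zero_on_line (f : Entire ι) (p v : ι → ℂ)
    (h : ∀ᶠ t : ℝ in 𝓝 0, f.1 (p + (t : ℂ) • v) = 0) (s : ℂ) : f.1 (p + s • v) = 0 := by
  have ha : AnalyticOnNhd ℂ (fun s : ℂ => f.1 (p + s • v)) univ := fun s _ =>
    (f.2 _ (mem_univ _)).comp (f := fun s : ℂ => p + s • v)
      (analyticAt_const.add (analyticAt_id.smul analyticAt_const))
  have hfreq : ∃ᶠ s : ℂ in 𝓝[≠] 0, f.1 (p + s • v) = 0 := by
    have ht : Tendsto (fun t : ℝ => (t : ℂ)) (𝓝[≠] 0) (𝓝[≠] 0) := by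
      refine tendsto_nhdsWithin_iff.2 ⟨?_, ?_⟩
      · exact (Complex.continuous_ofReal.tendsto' 0 0 (by simp)).mono_left nhdsWithin_le_nhds
      · filter_upwards [self_mem_nhdsWithin] with t ht
        simpa using ht
    exact ht.frequently (h.filter_mono nhdsWithin_le_nhds).frequently
  exact ha.eqOn_zero_of_preconnected_of_frequently_eq_zero isPreconnected_univ (mem_univ 0) hfreq
    (mem_univ s)

/-- An entire function vanishing on a nonempty open subset of `ℝ^ι` vanishes identically. -/
lemma Entire.eq_zero_of_real_open (f : Entire ι) {U : Set (ι → ℝ)} (hU : IsOpen U)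
    (hne : U.Nonempty) (h : ∀ u ∈ U, f.1 (realPoint u) = 0) : f = 0 := by
  obtain ⟨p, hp⟩ := hne
  -- Real lines through `p` reach all of `ℝ^ι`; complex lines with real base point and direction
  -- then reach all of `ℂ^ι`.
  have hreal : ∀ x : ι → ℝ, f.1 (realPoint x) = 0 := by
    intro x
    have hc : ContinuousAt (fun t : ℝ => p + t • (x - p)) 0 := by fun_prop
    have hev : ∀ᶠ t : ℝ in 𝓝 0, f.1 (realPoint p + (t : ℂ) • realPoint (x - p)) = 0 := by
      have : ∀ᶠ t : ℝ in 𝓝 0, p + t • (x - p) ∈ U :=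
        hc.eventually (by simpa using hU.mem_nhds hp)
      filter_upwards [this] with t ht
      rw [← realPoint_smul, ← realPoint_add]
      exact h _ ht
    simpa [← realPoint_add] using Entire.eq_zero_on_line f _ _ hev 1
  refine Subtype.ext (funext fun z => ?_)
  have := Entire.eq_zero_on_line f (realPoint fun i => (z i).re) (realPoint fun i => (z i).im)
    (Eventually.of_forall fun t => by rw [← realPoint_smul, ← realPoint_add]; exact hreal _)
    Complex.I
  rwa [realPoint_re_add_im] at this

/-! ### Values of meromorphic functions -/

/-- The meromorphic function `F` takes the values `φ` along the map `e`, up to removable zeros of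
the denominator. -/
def HasValues {X : Type} (F : Mero ι) (e : X → ι → ℂ) (φ : X → ℂ) : Prop :=
  ∃ g h : Entire ι, IsQuotient F g h ∧ ∀ x, g.1 (e x) = φ x * h.1 (e x)

lemma Mero.algebraMap_ne_zero {h : Entire ι} (hh : h ≠ 0) :
    algebraMap (Entire ι) (Mero ι) h ≠ 0 :=
  (map_ne_zero_iff _ (IsFractionRing.injective (Entire ι) (Mero ι))).2 hh

namespace HasValues

variable {X : Type} {F G : Mero ι} {e : X → ι → ℂ} {φ ψ : X → ℂ}

lemma const (c : ℂ) : HasValues (algebraMap ℂ (Mero ι) c) e (fun _ => c) := by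
  refine ⟨algebraMap ℂ (Entire ι) c, 1, ⟨one_ne_zero, ?_⟩, fun x => ?_⟩
  · rw [map_one, div_one, ← IsScalarTower.algebraMap_apply]
  · exact (mul_one c).symm

lemma add (hF : HasValues F e φ) (hG : HasValues G e ψ) :
    HasValues (F + G) e (fun x => φ x + ψ x) := by
  obtain ⟨g, h, ⟨hh, rfl⟩, hv⟩ := hF
  obtain ⟨g', h', ⟨hh', rfl⟩, hv'⟩ := hG
  refine ⟨g * h' + h * g', h * h', ⟨mul_ne_zero hh hh', ?_⟩, fun x => ?_⟩
  · rw [div_add_div _ _ (Mero.algebraMap_ne_zero hh) (Mero.algebraMap_ne_zero hh')]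
    simp only [map_add, map_mul]
  · change g.1 (e x) * h'.1 (e x) + h.1 (e x) * g'.1 (e x) = _ * (h.1 (e x) * h'.1 (e x))
    rw [hv, hv']
    ring

lemma mul (hF : HasValues F e φ) (hG : HasValues G e ψ) :
    HasValues (F * G) e (fun x => φ x * ψ x) := by
  obtain ⟨g, h, ⟨hh, rfl⟩, hv⟩ := hF
  obtain ⟨g', h', ⟨hh', rfl⟩, hv'⟩ := hG
  refine ⟨g * g', h * h', ⟨mul_ne_zero hh hh', ?_⟩, fun x => ?_⟩
  · rw [div_mul_div_comm]
    simp only [map_mul]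
  · change g.1 (e x) * g'.1 (e x) = _ * (h.1 (e x) * h'.1 (e x))
    rw [hv, hv']
    ring

/-- Carries a polynomial relation between pointwise values to the field of meromorphic functions;
values are never divided, so zeros of denominators do no harm. -/
lemma aeval {τ : Type} {F : τ → Mero ι} {φ : τ → X → ℂ} (h : ∀ i, HasValues (F i) e (φ i))
    (P : MvPolynomial τ ℂ) :
    HasValues (MvPolynomial.aeval F P) e (fun x => MvPolynomial.eval (fun i => φ i x) P) := by
  induction P using MvPolynomial.induction_on with
  | C c => simpa using const c
  | add p q hp hq => simpa only [map_add] using hp.add hq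
  | mul_X p i hp =>
    simpa only [map_mul, MvPolynomial.aeval_X, MvPolynomial.eval_X] using hp.mul (h i)

lemma comp {F : Mero κ} {σ : (ι → ℂ) → (κ → ℂ)} (hσ : AnalyticOnNhd ℂ σ univ)
    (hs : Function.Surjective σ) (h : HasValues F (fun x => σ (e x)) φ) :
    HasValues (Mero.comp σ hσ hs F) e φ := by
  obtain ⟨g, h, ⟨hh, rfl⟩, hv⟩ := h
  refine ⟨Entire.comp σ hσ g, Entire.comp σ hσ h, ⟨?_, ?_⟩, hv⟩
  · exact (map_ne_zero_iff _ (Entire.comp_injective σ hσ hs)).2 hh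
  · rw [map_div₀, Mero.comp_algebraMap, Mero.comp_algebraMap]

lemma eq_zero {U : Set (ι → ℝ)} (hU : IsOpen U) (hne : U.Nonempty)
    (h : HasValues F (fun u : U => realPoint u.1) (fun _ => 0)) : F = 0 := by
  obtain ⟨g, h, ⟨hh, rfl⟩, hv⟩ := h
  have : g = 0 := Entire.eq_zero_of_real_open g hU hne fun u hu => by simpa using hv ⟨u, hu⟩
  simp [this]

end HasValues

/-! ### Periods and algebraic dependence -/

lemma Mero.comp_algebraMap_complex (σ : (κ → ℂ) → (ι → ℂ)) (hσ : AnalyticOnNhd ℂ σ univ)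
    (hs : Function.Surjective σ) (c : ℂ) :
    Mero.comp σ hσ hs (algebraMap ℂ (Mero ι) c) = algebraMap ℂ (Mero κ) c := by
  rw [IsScalarTower.algebraMap_apply ℂ (Entire ι) (Mero ι), Mero.comp_algebraMap,
    IsScalarTower.algebraMap_apply ℂ (Entire κ) (Mero κ)]
  rfl

/-- Translation by `a` corresponds to translation by `b` under composition with a map `σ` such that
`σ (u + a) = σ u + b`. -/
lemma Mero.translate_comp (σ : (ι → ℂ) → (κ → ℂ)) (hσ : AnalyticOnNhd ℂ σ univ)
    (hs : Function.Surjective σ) {a : ι → ℂ} {b : κ → ℂ} (h : ∀ u, σ (u + a) = σ u + b)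
    (F : Mero κ) :
    Mero.translate a (Mero.comp σ hσ hs F) = Mero.comp σ hσ hs (Mero.translate b F) := by
  have : (Mero.translate a).comp (Mero.comp σ hσ hs) =
      (Mero.comp σ hσ hs).comp (Mero.translate b) := by
    refine IsLocalization.ringHom_ext (nonZeroDivisors (Entire κ)) (RingHom.ext fun g => ?_)
    simp only [RingHom.comp_apply, Mero.translate_algebraMap, Mero.comp_algebraMap]
    refine congrArg _ (Subtype.ext (funext fun z => ?_))
    simp [Entire.comp, h]
  exact DFunLike.congr_fun this F

/-- Isolates the variable `none`, so that a relation between `G` and `f` exhibits `G` as a root of a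
one-variable polynomial. -/
lemma eval₂_optionEquivLeft {τ : Type} {K : Type} [CommRing K] [Algebra ℂ K] (f : τ → K) (G : K)
    (P : MvPolynomial (Option τ) ℂ) :
    (MvPolynomial.optionEquivLeft ℂ τ P).eval₂ (MvPolynomial.aeval f).toRingHom G =
      MvPolynomial.aeval (fun o : Option τ => o.elim G f) P := by
  induction P using MvPolynomial.induction_on with
  | C c => simp [MvPolynomial.optionEquivLeft_C]
  | add p q hp hq => simp only [map_add, Polynomial.eval₂_add, hp, hq]
  | mul_X p i hp =>
    rw [map_mul, Polynomial.eval₂_mul, hp, map_mul]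
    cases i <;> simp [MvPolynomial.optionEquivLeft_X_none, MvPolynomial.optionEquivLeft_X_some]

/-- A function algebraic over `ℂ(f)` is fixed by translation by a multiple of any period of `f`. -/
lemma exists_nsmul_translate_eq {τ : Type} {f : τ → Mero ι} (hf : AlgebraicIndependent ℂ f) {G : Mero ι}
    {P : MvPolynomial (Option τ) ℂ} (hP : P ≠ 0)
    (h : MvPolynomial.aeval (fun o : Option τ => o.elim G f) P = 0) {a : ι → ℂ}
    (ha : a ∈ periodGroup f) : ∃ m : ℕ, 0 < m ∧ Mero.translate (m • a) G = G := by
  set Q : Polynomial (Mero ι) :=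
    (MvPolynomial.optionEquivLeft ℂ τ P).map (MvPolynomial.aeval f).toRingHom with hQdef
  -- Algebraic independence makes evaluation at `f` injective, so no nonzero coefficient is lost.
  have hQ : Q ≠ 0 := by
    refine (Polynomial.map_ne_zero_iff (f := (MvPolynomial.aeval f).toRingHom) hf).2 ?_
    simpa using hP
  -- Translation by a period fixes the coefficients of `Q`.
  have hroot : ∀ b ∈ periodGroup f, Mero.translate b G ∈ {x | Q.IsRoot x} := by
    intro b hb
    change Q.eval _ = 0
    rw [hQdef, Polynomial.eval_map, eval₂_optionEquivLeft]
    have := congrArg (Mero.translate b) h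
    rw [map_zero, MvPolynomial.map_aeval] at this
    rw [← this, MvPolynomial.aeval_def, MvPolynomial.coe_eval₂Hom]
    congr 1
    · exact RingHom.ext fun c => (Mero.comp_algebraMap_complex _ _ (surjective_translate b) c).symm
    · funext o
      cases o with
      | none => rfl
      | some i => exact (hb i).symm
  have hfin : {x | Q.IsRoot x}.Finite := Polynomial.finite_setOfPred_isRoot hQ
  have hmaps : MapsTo (fun m : ℕ => Mero.translate (m • a) G) univ {x | Q.IsRoot x} :=
    fun m _ => hroot _ (nsmul_mem ha m)
  -- Pigeonhole: two multiples of `a` move `G` to the same root, so their difference fixes `G`.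
  obtain ⟨m, _, m', _, hlt, heq⟩ := infinite_univ.exists_lt_map_eq_of_mapsTo hmaps hfin
  refine ⟨m' - m, Nat.sub_pos_of_lt hlt, (Mero.translate (m • a)).injective ?_⟩
  rw [← Mero.translate_add, ← add_nsmul, Nat.sub_add_cancel hlt.le]
  exact heq.symm

/-! ### Transfer of periods along an isomorphism -/

/-- A continuous additive automorphism of `ℝ^ι` extends to a complex linear automorphism
of `ℂ^ι`. -/
lemma exists_complexification [DecidableEq ι] (α : (ι → ℝ) ≃+ (ι → ℝ)) (hα : Continuous α) :
    ∃ T : (ι → ℂ) ≃L[ℂ] (ι → ℂ), ∀ x, T (realPoint x) = realPoint (α x) := by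
  set L : (ι → ℝ) →L[ℝ] (ι → ℝ) := (α : (ι → ℝ) →+ (ι → ℝ)).toRealLinearMap hα
  set M : Matrix ι ι ℂ := (LinearMap.toMatrix' L.toLinearMap).map Complex.ofRealHom
  have hMx : ∀ x, M.mulVec (realPoint x) = realPoint (α x) := by
    intro x
    ext i
    have h1 : (LinearMap.toMatrix' L.toLinearMap).mulVec x = α x :=
      LinearMap.toMatrix'_mulVec L.toLinearMap x
    have h2 := congrArg Complex.ofRealHom (congrFun h1 i)
    rw [RingHom.map_mulVec] at h2
    exact h2
  -- `M` preserves real vectors, so the real and imaginary parts of a kernel vector are killed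
  -- separately by `α`.
  have hinj : Function.Injective (Matrix.mulVecLin M) := by
    rw [← LinearMap.ker_eq_bot, LinearMap.ker_eq_bot']
    intro z hz
    rw [Matrix.mulVecLin_apply, ← realPoint_re_add_im z, Matrix.mulVec_add, Matrix.mulVec_smul,
      hMx, hMx] at hz
    have hre : α (fun i => (z i).re) = 0 := by
      ext i; simpa [realPoint] using congrArg Complex.re (congrFun hz i)
    have him : α (fun i => (z i).im) = 0 := by
      ext i; simpa [realPoint] using congrArg Complex.im (congrFun hz i)
    rw [EmbeddingLike.map_eq_zero_iff] at hre him
    ext i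
    exact Complex.ext (congrFun hre i) (congrFun him i)
  exact ⟨(LinearEquiv.ofInjectiveEndo _ hinj).toContinuousLinearEquiv, hMx⟩

lemma Mero.translate_nsmul_eq {F : Mero ι} {a : ι → ℂ} (h : Mero.translate a F = F) (m : ℕ) :
    Mero.translate (m • a) F = F :=
  nsmul_mem (show a ∈ periodGroup fun _ : Unit => F from fun _ => h) m ()

lemma IsChartOf.exists_hasValues {f : ι → Mero ι}
    {φ : OpenPartialHomeomorph (ι → ℝ) (ι → ℝ)} (hφ : IsChartOf f φ) :
    ∃ k : ι → ℝ, ∀ i, ∀ (X : Type) (u : X → ι → ℝ), (∀ x, u x ∈ φ.source) →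
      HasValues (f i) (fun x => realPoint (u x + k)) (fun x => (φ (u x) i : ℂ)) := by
  obtain ⟨-, -, -, k, hk⟩ := hφ
  refine ⟨k, fun i X u hu => ?_⟩
  obtain ⟨p, q, hq, hpq⟩ := hk i
  exact ⟨p, q, hq, fun x => hpq _ (hu x)⟩

/-- A locally Nash homomorphism between `(ℝ^ι, +, f)` and `(ℝ^ι, +, g)` makes the coordinates of `g`
algebraic over `ℂ(f)`, up to an affine change of variables; so it maps some multiple of each
period of `f` to a period of `g`. -/
lemma exists_nsmul_mem_periodGroup {f g : ι → Mero ι} (hf : AlgebraicIndependent ℂ f)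
    {φ ψ : OpenPartialHomeomorph (ι → ℝ) (ι → ℝ)} (hφ : IsChartOf f φ) (hψ : IsChartOf g ψ)
    {α : (ι → ℝ) ≃+ (ι → ℝ)}
    (hα : IsLocallyNashMap (translateAtlas φ) (translateAtlas ψ) α)
    {T : (ι → ℂ) ≃L[ℂ] (ι → ℂ)} (hT : ∀ x, T (realPoint x) = realPoint (α x))
    {a : ι → ℂ} (ha : a ∈ periodGroup f) :
    ∃ m : ℕ, 0 < m ∧ m • T a ∈ periodGroup g := by
  have hψ0 := hψ.1
  obtain ⟨k, hk⟩ := hφ.exists_hasValues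
  obtain ⟨l, hl⟩ := hψ.exists_hasValues
  -- The target chart is `ψ` translated by `0`; the source chart is a translate of `φ` by an unknown
  -- `x`.
  obtain ⟨_, ⟨x, rfl⟩, U, hU, hUs, hU0, hα0, -, -, hN⟩ :=
    hα.2 0 _ ⟨0, rfl⟩ (show α 0 ∈ _ by simpa using hψ0)
  set χ := (Homeomorph.addLeft (-x)).transOpenPartialHomeomorph φ with hχ
  have hχs : ∀ u ∈ U, u - x ∈ φ.source := fun u hu => by
    have := hUs hu
    simpa [hχ, sub_eq_neg_add] using this
  have hχa : ∀ u, χ u = φ (u - x) := fun u => by simp [hχ, sub_eq_neg_add]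
  have hαs : ∀ u ∈ U, α u ∈ ψ.source := fun u hu => by
    simpa using hα0 (mem_image_of_mem α hu)
  -- In the coordinate `w = u - x + k` the source chart takes the values `f(w)`.
  set V : Set (ι → ℝ) := (fun w => w - k + x) ⁻¹' U with hV
  have hVo : IsOpen V := hU.preimage (by fun_prop)
  have hVn : V.Nonempty := ⟨k - x, by simpa [hV] using hU0⟩
  have hval : ∀ i, HasValues (f i) (fun w : V => realPoint w.1) (fun w => (φ (w.1 - k) i : ℂ)) := by
    intro i
    simpa using hk i V (fun w => w.1 - k) fun w => by simpa using hχs _ w.2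
  -- Chosen so that `g(σ w)` takes the values `ψ (α u)`, where `u = w - k + x`.
  set σ : (ι → ℂ) → (ι → ℂ) := fun z => T (z - realPoint k + realPoint x) + realPoint l with hσdef
  have hσ : AnalyticOnNhd ℂ σ univ := fun z _ =>
    (((T : (ι → ℂ) →L[ℂ] (ι → ℂ)).analyticAt _).comp
      ((analyticAt_id.sub analyticAt_const).add analyticAt_const)).add analyticAt_const
  have hσs : Function.Surjective σ := fun w =>
    ⟨T.symm (w - realPoint l) - realPoint x + realPoint k, by simp [hσdef]⟩
  have hσr : ∀ w, σ (realPoint w) = realPoint (α (w - k + x) + l) := by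
    intro w
    rw [hσdef, realPoint_add, ← hT, realPoint_add, realPoint_sub]
  have hmul : ∀ j, ∃ m : ℕ, 0 < m ∧ Mero.translate (m • T a) (g j) = g j := by
    intro j
    obtain ⟨P, hP, hPz⟩ := exists_polynomial_of_isSemialgebraic_graph (hN j).2
    have hG : HasValues (Mero.comp σ hσ hσs (g j)) (fun w : V => realPoint w.1)
        (fun w => (ψ (α (w.1 - k + x)) j : ℂ)) := by
      refine HasValues.comp hσ hσs ?_
      simp only [hσr]
      exact hl j V (fun w => α (w.1 - k + x)) fun w => hαs _ w.2
    have hz : MvPolynomial.aeval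
        (fun o : Option ι => o.elim (Mero.comp σ hσ hσs (g j)) f)
        (P.map Complex.ofRealHom) = 0 := by
      refine HasValues.eq_zero hVo hVn ?_
      have h := HasValues.aeval (X := V) (e := fun w : V => realPoint w.1)
        (F := fun o : Option ι => o.elim (Mero.comp σ hσ hσs (g j)) f)
        (φ := fun o w => ((o.elim (ψ (α (w.1 - k + x)) j) (φ (w.1 - k)) : ℝ) : ℂ))
        (fun o => by cases o with
          | none => exact hG
          | some i => exact hval i) (P.map Complex.ofRealHom)
      convert h using 2 with w
      have h0 := hPz _ (mem_image_of_mem χ w.2)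
      have h1 : χ.symm (χ (w.1 - k + x)) = w.1 - k + x := χ.left_inv (hUs w.2)
      have h2 : ψ (-0 + α (χ.symm (χ (w.1 - k + x)))) = ψ (α (w.1 - k + x)) := by
        rw [h1, neg_zero, zero_add]
      have h3 : χ (w.1 - k + x) = φ (w.1 - k) := by rw [hχa, add_sub_cancel_right]
      replace h0 : MvPolynomial.eval (fun o : Option ι =>
          o.elim (ψ (-0 + α (χ.symm (χ (w.1 - k + x)))) j) (χ (w.1 - k + x))) P = 0 := h0
      rw [h2, h3] at h0
      rw [MvPolynomial.eval_map]
      exact (congrArg Complex.ofRealHom h0).symm.trans (MvPolynomial.eval₂_comp _ _ _)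
    have hP' : P.map Complex.ofRealHom ≠ 0 :=
      (MvPolynomial.map_injective _ Complex.ofRealHom.injective).ne_iff' (map_zero _) |>.2 hP
    obtain ⟨m, hm, hmG⟩ := exists_nsmul_translate_eq hf hP' hz ha
    -- Since `σ (u + m • a) = σ u + m • T a`, invariance of `g_j ∘ σ` under `m • a` is invariance of
    -- `g_j` under `m • T a`.
    refine ⟨m, hm, (Mero.comp σ hσ hσs).injective ?_⟩
    rw [← Mero.translate_comp σ hσ hσs (a := m • a) _ (g j), hmG]
    intro u
    rw [← map_nsmul]
    simp only [hσdef, map_add, map_sub]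
    abel
  choose m hm hmg using hmul
  -- A common multiple works for all coordinates at once.
  refine ⟨∏ j, m j, Finset.prod_pos fun j _ => hm j, fun j => ?_⟩
  obtain ⟨c, hc⟩ := Finset.dvd_prod_of_mem m (Finset.mem_univ j)
  rw [hc, mul_comm, mul_nsmul']
  exact Mero.translate_nsmul_eq (hmg j) c

/-! ### Discreteness of the period group -/

/-- A meromorphic map with a real analytic chart is a local diffeomorphism at some point, so it has
no small periods. -/
lemma eventually_eq_zero_of_mem_periodGroup {f : ι → Mero ι}
    {φ : OpenPartialHomeomorph (ι → ℝ) (ι → ℝ)} (hφ : IsChartOf f φ) :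
    ∀ᶠ a in 𝓝 (0 : ι → ℂ), a ∈ periodGroup f → a = 0 := by
  obtain ⟨hφ0, hφa, hφs, k, hk⟩ := hφ
  choose p q hq hpq using hk
  -- The product of the denominators is a nonzero entire function, so it cannot vanish on a real
  -- open set.
  obtain ⟨u, hu, hqu⟩ : ∃ u ∈ φ.source, (∏ i, q i).1 (realPoint (u + k)) ≠ 0 := by
    by_contra! H
    refine Finset.prod_ne_zero_iff.2 (fun i _ => (hq i).1) (Entire.eq_zero_of_real_open (∏ i, q i)
      (U := (fun w => w - k) ⁻¹' φ.source) (φ.open_source.preimage (by fun_prop))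
      ⟨k, by simpa using hφ0⟩ fun w hw => ?_)
    simpa using H _ hw
  set c : ι → ℂ := realPoint (u + k) with hc
  have hqc : ∀ i, (q i).1 c ≠ 0 := by
    intro i hi
    refine hqu ?_
    obtain ⟨r, hr⟩ := Finset.dvd_prod_of_mem q (Finset.mem_univ i)
    rw [hr]
    change (q i).1 c * r.1 c = 0
    rw [hi, zero_mul]
  set F : (ι → ℂ) → (ι → ℂ) := fun z i => (p i).1 z / (q i).1 z with hF
  have hFa : AnalyticAt ℂ F c := AnalyticAt.pi fun i =>
    ((p i).2 c (mem_univ _)).div ((q i).2 c (mem_univ _)) (hqc i)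
  have hFφ : ∀ᶠ v in 𝓝 u, F (realPoint (v + k)) = realPoint (φ v) := by
    have hcont : Continuous fun v : ι → ℝ => realPoint (v + k) := by
      unfold realPoint; fun_prop
    have hne : ∀ᶠ v in 𝓝 u, ∀ i, (q i).1 (realPoint (v + k)) ≠ 0 := by
      refine eventually_all.2 fun i => ?_
      exact (((q i).2 c (mem_univ _)).continuousAt.comp_of_eq hcont.continuousAt
        hc.symm).eventually_ne (hqc i)
    filter_upwards [hne, φ.open_source.mem_nhds hu] with v hv hvs
    ext i
    exact (div_eq_iff (hv i)).2 (hpq i v hvs)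
  have hFs := hFa.hasStrictFDerivAt
  set D := fderiv ℂ F c
  set E := fderiv ℝ φ u
  -- On real vectors the complex derivative is that of the chart: differentiate `hFφ` along `u + t •
  -- v`.
  have hDE : ∀ v, D (realPoint v) = realPoint (E v) := by
    intro v
    have hline : HasDerivAt (fun t : ℝ => u + t • v) v 0 := by
      simpa using ((hasDerivAt_id (0 : ℝ)).smul_const v).const_add u
    have h1 : HasDerivAt (fun t : ℝ => φ (u + t • v)) (E v) 0 :=
      HasFDerivAt.comp_hasDerivAt_of_eq 0 (hφa u hu).differentiableAt.hasFDerivAt hline (by simp)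
    have h2 : HasDerivAt (fun t : ℝ => realPoint (φ (u + t • v))) (realPoint (E v)) 0 :=
      hasDerivAt_pi.2 fun i => (hasDerivAt_pi.1 h1 i).ofReal_comp
    have hline' : HasDerivAt (fun t : ℝ => realPoint (u + t • v + k)) (realPoint v) 0 :=
      hasDerivAt_pi.2 fun i => ((hasDerivAt_pi.1 hline i).add_const (k i)).ofReal_comp
    have h3 : HasDerivAt (fun t : ℝ => F (realPoint (u + t • v + k))) (D (realPoint v)) 0 :=
      HasFDerivAt.comp_hasDerivAt_of_eq 0 (hFs.hasFDerivAt.restrictScalars ℝ) hline' (by simp [hc])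
    refine h3.unique (h2.congr_of_eventuallyEq ?_)
    have : Tendsto (fun t : ℝ => u + t • v) (𝓝 0) (𝓝 u) :=
      (by fun_prop : Continuous fun t : ℝ => u + t • v).tendsto' _ _ (by simp)
    exact this.eventually hFφ
  have hEinj : ∀ v, E v = 0 → v = 0 := by
    intro v hv
    have h1 : HasFDerivAt (φ.symm ∘ φ) ((fderiv ℝ φ.symm (φ u)).comp E) u :=
      (hφs _ (φ.map_source hu)).differentiableAt.hasFDerivAt.comp u
        (hφa u hu).differentiableAt.hasFDerivAt
    have h2 : HasFDerivAt (φ.symm ∘ φ) (ContinuousLinearMap.id ℝ (ι → ℝ)) u :=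
      (hasFDerivAt_id u).congr_of_eventuallyEq (φ.eventually_left_inverse hu)
    have h3 := DFunLike.congr_fun (h1.unique h2) v
    simpa [hv] using h3.symm
  have hDinj : Function.Injective D := by
    refine (injective_iff_map_eq_zero D).2 fun z hz => ?_
    rw [← realPoint_re_add_im z, map_add, map_smul, hDE, hDE] at hz
    have hre : E (fun i => (z i).re) = 0 := by
      ext i; simpa [realPoint] using congrArg Complex.re (congrFun hz i)
    have him : E (fun i => (z i).im) = 0 := by
      ext i; simpa [realPoint] using congrArg Complex.im (congrFun hz i)
    ext i
    exact Complex.ext (congrFun (hEinj _ hre) i) (congrFun (hEinj _ him) i)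
  let T : (ι → ℂ) ≃L[ℂ] (ι → ℂ) :=
    (LinearEquiv.ofInjectiveEndo D.toLinearMap hDinj).toContinuousLinearEquiv
  have hTD : (T : (ι → ℂ) →L[ℂ] (ι → ℂ)) = D := by
    ext v i
    rfl
  have hFe : HasStrictFDerivAt F (T : (ι → ℂ) →L[ℂ] (ι → ℂ)) c := hTD ▸ hFs
  -- The inverse function theorem makes `F` injective near `c`; a small period `a` gives `F (c + a)
  -- = F c`, whence `a = 0`.
  have hloc := hFe.eventually_left_inverse
  have hadd : Tendsto (fun a : ι → ℂ => c + a) (𝓝 0) (𝓝 c) :=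
    (by fun_prop : Continuous fun a : ι → ℂ => c + a).tendsto' _ _ (by simp)
  have hne : ∀ᶠ a in 𝓝 (0 : ι → ℂ), ∀ i, (q i).1 (c + a) ≠ 0 :=
    eventually_all.2 fun i =>
      hadd.eventually (((q i).2 c (mem_univ _)).continuousAt.eventually_ne (hqc i))
  filter_upwards [hadd.eventually hloc, hne] with a h1 h2 ha
  have hFc : F (c + a) = F c := by
    ext i
    have := (Mero.translate_eq_iff (hq i) a).1 (ha i) c
    rw [hF]
    dsimp only
    rw [div_eq_div_iff (h2 i) (hqc i)]
    linear_combination -this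
  have h0 := hloc.self_of_nhds
  rw [hFc, h0] at h1
  simpa using h1.symm

lemma discreteTopology_periodGroup {f : ι → Mero ι}
    {φ : OpenPartialHomeomorph (ι → ℝ) (ι → ℝ)} (hφ : IsChartOf f φ) :
    DiscreteTopology (periodGroup f) := by
  refine discreteTopology_iff_isOpen_singleton_zero.2 ?_
  rw [isOpen_singleton_iff_nhds_eq_pure, nhds_subtype_eq_comap]
  refine le_antisymm ?_ (by rw [← nhds_subtype_eq_comap]; exact pure_le_nhds _)
  rw [le_pure_iff]
  refine ⟨_, eventually_eq_zero_of_mem_periodGroup hφ, fun a ha => ?_⟩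
  exact Subtype.ext (ha a.2)

/-! ### Comparison of ranks -/

/-- If an injective additive map sends a multiple of each element of `Γ` into `Δ`, then the rank
of `Γ` is at most that of `Δ`. -/
lemma finrank_le_of_exists_nsmul_mem {E F : Type*} [AddCommGroup E] [AddCommGroup F]
    [IsAddTorsionFree E] (Γ : AddSubgroup E) (Δ : AddSubgroup F) [Module.Finite ℤ Γ]
    [Module.Finite ℤ Δ] (T : E →+ F) (hT : Function.Injective T)
    (h : ∀ a ∈ Γ, ∃ m : ℕ, 0 < m ∧ m • T a ∈ Δ) : Module.finrank ℤ Γ ≤ Module.finrank ℤ Δ := by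
  obtain ⟨S, hS⟩ := (Module.Finite.fg_top : (⊤ : Submodule ℤ Γ).FG)
  choose m hm hmΔ using fun a : Γ => h a a.2
  -- A common multiple over a finite generating set; by additivity it then serves for all of `Γ`.
  set N := ∏ a ∈ S, m a with hNdef
  have hN : 0 < N := Finset.prod_pos fun a _ => hm a
  set μ : Γ →+ F := (N • T).comp Γ.subtype
  have hle : (⊤ : Submodule ℤ Γ) ≤ (AddSubgroup.toIntSubmodule Δ).comap μ.toIntLinearMap := by
    rw [← hS, Submodule.span_le]
    intro a ha
    obtain ⟨c, hc⟩ := Finset.dvd_prod_of_mem m ha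
    change N • T a ∈ Δ
    rw [hNdef, hc, mul_comm, mul_nsmul']
    exact nsmul_mem (hmΔ a) c
  have hmem : ∀ a : Γ, μ a ∈ Δ := fun a => hle (Submodule.mem_top (x := a))
  refine LinearMap.finrank_le_finrank_of_injective (f := (μ.codRestrict Δ hmem).toIntLinearMap) ?_
  intro a b hab
  have h1 : N • T a = N • T b := congrArg Subtype.val hab
  rw [← map_nsmul, ← map_nsmul] at h1
  exact Subtype.ext (nsmul_right_injective hN.ne' (hT h1))

/-- Discrete subgroups of a finite-dimensional real space are finitely generated; so
`Module.finrank` is the true rank, not a default `0`. -/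
lemma finite_periodGroup (f : ι → Mero ι) [DiscreteTopology (periodGroup f)] :
    Module.Finite ℤ (periodGroup f) :=
  have : DiscreteTopology (AddSubgroup.toIntSubmodule (periodGroup f)) :=
    inferInstanceAs (DiscreteTopology (periodGroup f))
  instModuleFinite_of_discrete_submodule (E := ι → ℂ) (AddSubgroup.toIntSubmodule (periodGroup f))

lemma finrank_periodGroup_le [DecidableEq ι] {f g : ι → Mero ι} (hf : AlgebraicIndependent ℂ f)
    {φ ψ : OpenPartialHomeomorph (ι → ℝ) (ι → ℝ)} (hφ : IsChartOf f φ) (hψ : IsChartOf g ψ)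
    {α : (ι → ℝ) ≃+ (ι → ℝ)}
    (hα : IsLocallyNashMap (translateAtlas φ) (translateAtlas ψ) α) :
    Module.finrank ℤ (periodGroup f) ≤ Module.finrank ℤ (periodGroup g) := by
  obtain ⟨T, hT⟩ := exists_complexification α hα.1
  have := discreteTopology_periodGroup hφ
  have := discreteTopology_periodGroup hψ
  have := finite_periodGroup f
  have := finite_periodGroup g
  exact finrank_le_of_exists_nsmul_mem _ _ (T : (ι → ℂ) →+ (ι → ℂ)) T.injective
    fun a ha => exists_nsmul_mem_periodGroup hf hφ hψ hα hT ha

end LocallyNash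

theorem proposition4p9 (n : ℕ) (f g : Fin n → LocallyNash.Mero (Fin n))
    (hf : LocallyNash.IsRealMeromorphic f) (hg : LocallyNash.IsRealMeromorphic g)
    (hf_aat : LocallyNash.AdmitsAAT f) (hg_aat : LocallyNash.AdmitsAAT g)
    (A B : Set (OpenPartialHomeomorph (Fin n → ℝ) (Fin n → ℝ)))
    (hA : LocallyNash.IsStructureOf f A) (hB : LocallyNash.IsStructureOf g B)
    (hAB : LocallyNash.LocallyNashIsomorphic A B) :
    DiscreteTopology (LocallyNash.periodGroup f) ∧ DiscreteTopology (LocallyNash.periodGroup g) ∧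
      Module.finrank ℤ (LocallyNash.periodGroup f) =
        Module.finrank ℤ (LocallyNash.periodGroup g) := by
  obtain ⟨⟨φ, hφ, rfl⟩, -⟩ := hA
  obtain ⟨⟨ψ, hψ, rfl⟩, -⟩ := hB
  obtain ⟨α, hα, hα'⟩ := hAB
  exact ⟨LocallyNash.discreteTopology_periodGroup hφ, LocallyNash.discreteTopology_periodGroup hψ,
    le_antisymm (LocallyNash.finrank_periodGroup_le hf_aat.1 hφ hψ hα)
      (LocallyNash.finrank_periodGroup_le hg_aat.1 hψ hφ hα')⟩
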